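/- Let $N\in\mathbb N$, $q>1$, $\delta\ge 1$, $\eta_-,\eta_+\ge 0$, $M\ge 0$, and let $p$ be the conjugate exponent of $q$, i.e. $\frac1p+\frac1q=1$. Then there is a constant $\theta>p$, depending only on $q,\delta,N,\eta_\pm,M$, and for every $\rho>0$ there is a constant $C=C(\rho)\ge 0$, depending only on $\rho,q,\delta,N,\eta_\pm,M$, such that the following holds. Let $\mathcal O\subset\mathbb R^N_x\times\mathbb R_t$ be open, let $H:\mathcal O\times\mathbb R^N\to\mathbb R$ be a continuous function such that $$\frac1\delta|z|^q-\eta_-\le H(x,t,z)\le\delta|z|^q+\eta_+\qquad\forall (x,t,z)\in\mathcal O\times\mathbb R^N,$$ and let $u$ be a continuous viscosity solution of $$u_t+H(x,t,Du)=0\quad\text{in }\mathcal O$$ with $|u|\le M$ in $\mathcal O$. Put $\mathcal O_\rho=\{(x,t)\in\mathcal O:\ d_{\mathcal O^c}(x,t)>\rho\}$, where $d_{\mathcal O^c}$ is the Euclidean distance to the complement $\mathcal O^c$ of $\mathcal O$ in $\mathbb R^N\times\mathbb R$ (with $d_{\emptyset}=+\infty$). Then $$|u(x,t)-u(y,s)|\le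 C\left[|x-y|^{\frac{\theta-p}{\theta-1}}+|t-s|^{\frac{\theta-p}{\theta}}\right]\qquad\forall (x,t),(y,s)\in\mathcal O_\rho .$$ -/

import Mathlib

/-- `u` is a viscosity subsolution of `u_t + H(x,t,Du) = 0` in `O`: whenever `φ` is of class `C¹`
near `(x,t) ∈ O` and `u - φ` has a local maximum (relative to `O`) at `(x,t)`, one has
`φ_t(x,t) + H(x,t,Dφ(x,t)) ≤ 0`. -/
def IsViscositySubsolution {N : ℕ} (O : Set (EuclideanSpace ℝ (Fin N) × ℝ))
    (H : EuclideanSpace ℝ (Fin N) → ℝ → EuclideanSpace ℝ (Fin N) → ℝ)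
    (u : EuclideanSpace ℝ (Fin N) × ℝ → ℝ) : Prop :=
  ∀ (φ : EuclideanSpace ℝ (Fin N) × ℝ → ℝ) (x : EuclideanSpace ℝ (Fin N)) (t : ℝ),
    (x, t) ∈ O → ContDiffAt ℝ 1 φ (x, t) →
    IsLocalMaxOn (fun z => u z - φ z) O (x, t) →
    deriv (fun s => φ (x, s)) t + H x t (gradient (fun y => φ (y, t)) x) ≤ 0

/-- `u` is a viscosity supersolution of `u_t + H(x,t,Du) = 0` in `O`: whenever `φ` is of class `C¹`
near `(x,t) ∈ O` and `u - φ` has a local minimum (relative to `O`) at `(x,t)`, one has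
`φ_t(x,t) + H(x,t,Dφ(x,t)) ≥ 0`. -/
def IsViscositySupersolution {N : ℕ} (O : Set (EuclideanSpace ℝ (Fin N) × ℝ))
    (H : EuclideanSpace ℝ (Fin N) → ℝ → EuclideanSpace ℝ (Fin N) → ℝ)
    (u : EuclideanSpace ℝ (Fin N) × ℝ → ℝ) : Prop :=
  ∀ (φ : EuclideanSpace ℝ (Fin N) × ℝ → ℝ) (x : EuclideanSpace ℝ (Fin N)) (t : ℝ),
    (x, t) ∈ O → ContDiffAt ℝ 1 φ (x, t) →
    IsLocalMinOn (fun z => u z - φ z) O (x, t) →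
    0 ≤ deriv (fun s => φ (x, s)) t + H x t (gradient (fun y => φ (y, t)) x)

/-- A continuous viscosity solution of `u_t + H(x,t,Du) = 0` in `O`. -/
structure IsViscositySolution {N : ℕ} (O : Set (EuclideanSpace ℝ (Fin N) × ℝ))
    (H : EuclideanSpace ℝ (Fin N) → ℝ → EuclideanSpace ℝ (Fin N) → ℝ)
    (u : EuclideanSpace ℝ (Fin N) × ℝ → ℝ) : Prop where
  continuousOn : ContinuousOn u O
  subsolution : IsViscositySubsolution O H u
  supersolution : IsViscositySupersolution O H u

/-- The points of `O` whose Euclidean distance in `ℝ^N × ℝ` (hence the passage to `WithLp 2`) to the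
complement of `O` is larger than `ρ`. The distance to the empty set is `∞`. -/
def interiorRegion {N : ℕ} (O : Set (EuclideanSpace ℝ (Fin N) × ℝ)) (ρ : ℝ) :
    Set (EuclideanSpace ℝ (Fin N) × ℝ) :=
  {z | z ∈ O ∧ ENNReal.ofReal ρ < Metric.infEDist (WithLp.toLp 2 z) (WithLp.toLp 2 '' Oᶜ)}

/-!
The proof compares `u` with explicit smooth barriers and then runs an energy-decay argument along
almost optimal points; neither minimizing curves nor a comparison principle between viscosity
solutions is needed.

*Barriers.* Since `(p - 1) q = p`, the functions `± C ‖z - x₀‖ ^ p m(τ) ^ (1 - p)`, with `m` affine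
of slope `± 1`, are smooth super- or subsolutions of the model equations with Hamiltonians
`‖z‖ ^ q / δ` and `δ ‖z‖ ^ q` once `C` is large, respectively small. Comparing them with `u` on small
cylinders gives two estimates. The upper bound on the Hamiltonian yields, for each `(x, t)` and each
small `h`, some `y` with `u (y, t - h) + a ‖x - y‖ ^ p h ^ (1 - p) - B h ≤ u (x, t)`
(`IsViscositySupersolution.exists_backward_point`). The lower bound yields
`u (x, t) ≤ u (y, t - h) + A ‖x - y‖ ^ p h ^ (1 - p) + B h` for all `y` near `x`
(`IsViscositySubsolution.le_add_rpow`).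

*Energy decay.* Composing backward steps at the scales `h`, `h / l`, `h / l ^ 2`, … accumulates an
energy `g`. The second estimate, applied over the whole interval, is a reverse Hölder inequality: up
to a term linear in `h`, the energy is controlled by the total displacement. If the step from scale
`h` to scale `h / l` added only a small fraction of energy, the displacement would be too small for
that; so the energy grows by a factor `1 + γ` at each step, unless it is already `O(h)`
(`ReachesWithEnergy.exists_step`). As it is bounded at the top scale, the energy at scale `h` is
`O(h ^ β)` for some `β > 0` depending only on `p`, `a` and `A`
(`exists_energy_decay_exponent`).

*Conclusion.* The point `y` reached from `(x, t)` after time `h` thus satisfies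
`‖x - y‖ ^ p ≤ D h ^ (p - 1 + β)`, and the upper estimate from `(y, t - h)` to a second point
`(x', t')` gives `u (x', t') ≤ u (x, t) + C h ^ β` as soon as `|t - t'| ≤ h / 2` and
`‖x - x'‖ ^ p ≤ h ^ (p - 1 + β)` (`exists_one_sided_modulus`). With `θ = p / (1 - β)` this is the
asserted Hölder estimate.
-/

open Set Metric Topology Filter

/-! ### Barriers `g(τ) + k(τ) ‖z - x₀‖ ^ p` -/

theorem norm_gradient_const_add_mul_norm_rpow {N : ℕ} {p : ℝ} (hp : 1 < p) (c k : ℝ)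
    (x₀ z : EuclideanSpace ℝ (Fin N)) :
    ‖gradient (fun y => c + k * ‖y - x₀‖ ^ p) z‖ = |k| * (p * ‖z - x₀‖ ^ (p - 1)) := by
  have h0 : DifferentiableAt ℝ (fun y : EuclideanSpace ℝ (Fin N) => ‖y‖ ^ p) (z - x₀) :=
    differentiable_norm_rpow hp _
  have h1 : HasFDerivAt (fun y : EuclideanSpace ℝ (Fin N) => c + k * ‖y - x₀‖ ^ p)
      (k • fderiv ℝ (fun y : EuclideanSpace ℝ (Fin N) => ‖y‖ ^ p) (z - x₀)) z := by
    have := (hasFDerivAt_comp_sub x₀).2 h0.hasFDerivAt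
    exact (this.const_mul k).const_add c
  rw [gradient, LinearIsometryEquiv.norm_map, h1.fderiv, norm_smul, norm_fderiv_norm_id_rpow _ hp,
    Real.norm_eq_abs]

theorem contDiffAt_add_mul_norm_rpow {N : ℕ} {p : ℝ} (hp : 1 < p) {g k : ℝ → ℝ} {t : ℝ}
    (hg : ContDiffAt ℝ 1 g t) (hk : ContDiffAt ℝ 1 k t) (x₀ z : EuclideanSpace ℝ (Fin N)) :
    ContDiffAt ℝ 1 (fun w : EuclideanSpace ℝ (Fin N) × ℝ => g w.2 + k w.2 * ‖w.1 - x₀‖ ^ p)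
      (z, t) := by
  have h1 : ContDiff ℝ 1 (fun w : EuclideanSpace ℝ (Fin N) × ℝ => ‖w.1 - x₀‖ ^ p) :=
    (contDiff_fst.sub contDiff_const).norm_rpow hp
  exact (hg.comp (z, t) contDiffAt_snd).add ((hk.comp (z, t) contDiffAt_snd).mul h1.contDiffAt)

theorem deriv_add_mul_const {g k : ℝ → ℝ} {g' k' t : ℝ} (hg : HasDerivAt g g' t)
    (hk : HasDerivAt k k' t) (c : ℝ) :
    deriv (fun s => g s + k s * c) t = g' + k' * c :=
  (hg.add (hk.mul_const c)).deriv

/-- The homogeneity behind the barriers: for `C m ^ (1 - p) ‖z‖ ^ p` the `q`-th power of the norm of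
the gradient and the time derivative both scale like `m ^ (-p) ‖z‖ ^ p`. -/
theorem slope_rpow_eq {p q : ℝ} (hpq : p.HolderConjugate q) {C m r : ℝ} (hC : 0 ≤ C) (hm : 0 < m)
    (hr : 0 ≤ r) :
    (C * m ^ (1 - p) * (p * r ^ (p - 1))) ^ q = (p * C) ^ q * (m ^ (-p) * r ^ p) := by
  have hp := hpq.pos
  have e1 : (m ^ (1 - p)) ^ q = m ^ (-p) := by
    rw [← Real.rpow_mul hm.le]; congr 1; linarith [hpq.sub_one_mul_conj]
  have e2 : (r ^ (p - 1)) ^ q = r ^ p := by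
    rw [← Real.rpow_mul hr, hpq.sub_one_mul_conj]
  rw [← e1, ← e2, ← Real.mul_rpow (by positivity) (by positivity),
    ← Real.mul_rpow (by positivity) (by positivity)]
  congr 1; ring

/-- A constant `c` for which `-c ‖z‖ ^ p m ^ (1 - p)` is a subsolution for the Hamiltonian
`δ ‖z‖ ^ q`; since `q > 1`, small `c` will do. -/
theorem exists_pos_le_one_mul_rpow_le {p q δ : ℝ} (hpq : p.HolderConjugate q) (hδ : 0 < δ) :
    ∃ c : ℝ, 0 < c ∧ c ≤ 1 ∧ δ * (p * c) ^ q ≤ c * (p - 1) := by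
  have hp := hpq.pos
  have hp1 := hpq.sub_one_pos
  have hq := hpq.symm.sub_one_pos
  set X := (p - 1) / (δ * p ^ q) with hX
  have hX0 : 0 < X := by positivity
  have hc : 0 < min 1 (X ^ (1 / (q - 1))) := lt_min one_pos (by positivity)
  refine ⟨min 1 (X ^ (1 / (q - 1))), hc, min_le_left _ _, ?_⟩
  set c := min 1 (X ^ (1 / (q - 1)))
  have h1 : c ^ (q - 1) ≤ X := by
    calc c ^ (q - 1) ≤ (X ^ (1 / (q - 1))) ^ (q - 1) :=
          Real.rpow_le_rpow hc.le (min_le_right _ _) hq.le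
      _ = X := by rw [← Real.rpow_mul hX0.le, one_div_mul_cancel hq.ne', Real.rpow_one]
  have h2 : c ^ q = c * c ^ (q - 1) := by
    rw [← Real.rpow_one_add' hc.le (by linarith)]; congr 1; ring
  rw [Real.mul_rpow hp.le hc.le, h2]
  rw [hX, le_div_iff₀ (by positivity)] at h1
  nlinarith

/-- A constant `C` for which `C ‖z‖ ^ p m ^ (1 - p)` is a supersolution for the Hamiltonian
`‖z‖ ^ q / δ`; since `q > 1`, large `C` will do. -/
theorem exists_one_le_mul_le_rpow {p q δ : ℝ} (hpq : p.HolderConjugate q) (hδ : 0 < δ) :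
    ∃ C : ℝ, 1 ≤ C ∧ C * (p - 1) ≤ 1 / δ * (p * C) ^ q := by
  have hp := hpq.pos
  have hp1 := hpq.sub_one_pos
  have hq := hpq.symm.sub_one_pos
  set X := (p - 1) * δ / p ^ q with hX
  have hX0 : 0 < X := by positivity
  refine ⟨max 1 (X ^ (1 / (q - 1))), le_max_left _ _, ?_⟩
  set c := max 1 (X ^ (1 / (q - 1)))
  have hc : 0 < c := lt_of_lt_of_le one_pos (le_max_left _ _)
  have h1 : X ≤ c ^ (q - 1) := by
    calc X = (X ^ (1 / (q - 1))) ^ (q - 1) := by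
          rw [← Real.rpow_mul hX0.le, one_div_mul_cancel hq.ne', Real.rpow_one]
      _ ≤ c ^ (q - 1) := Real.rpow_le_rpow (by positivity) (le_max_right _ _) hq.le
  have h2 : c ^ q = c * c ^ (q - 1) := by
    rw [← Real.rpow_one_add' hc.le (by linarith)]; congr 1; ring
  rw [Real.mul_rpow hp.le hc.le, h2, one_div, inv_mul_eq_div, le_div_iff₀ hδ]
  rw [hX, div_le_iff₀ (by positivity)] at h1
  nlinarith

/-! ### Comparison with smooth functions on cylinders -/

/-- The ordering is required on the top `τ = T` of the cylinder too, so that the maximum of `u - φ`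
is a local maximum in `O` in both time directions, as the definition of subsolutions demands. -/
theorem IsViscositySubsolution.lt_of_strict_supersolution {N : ℕ}
    {O : Set (EuclideanSpace ℝ (Fin N) × ℝ)}
    {H : EuclideanSpace ℝ (Fin N) → ℝ → EuclideanSpace ℝ (Fin N) → ℝ}
    {u φ : EuclideanSpace ℝ (Fin N) × ℝ → ℝ} (hsub : IsViscositySubsolution O H u)
    (hu : ContinuousOn u O) {x₀ : EuclideanSpace ℝ (Fin N)} {R s T : ℝ}
    (hK : closedBall x₀ R ×ˢ Icc s T ⊆ O)
    (hφ : ∀ z, ∀ τ ∈ Icc s T, ContDiffAt ℝ 1 φ (z, τ))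
    (hbd : ∀ z ∈ closedBall x₀ R, ∀ τ ∈ Icc s T, (‖z - x₀‖ = R ∨ τ = s ∨ τ = T) →
      u (z, τ) < φ (z, τ))
    (hint : ∀ z, ∀ τ ∈ Icc s T, (z, τ) ∈ O →
      0 < deriv (fun r => φ (z, r)) τ + H z τ (gradient (fun y => φ (y, τ)) z)) :
    ∀ z ∈ closedBall x₀ R, ∀ τ ∈ Icc s T, u (z, τ) < φ (z, τ) := by
  intro z₁ hz₁ τ₁ hτ₁
  have hφc : ContinuousOn φ (closedBall x₀ R ×ˢ Icc s T) := fun w hw =>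
    (hφ w.1 w.2 hw.2).continuousAt.continuousWithinAt
  obtain ⟨⟨z, τ⟩, ⟨hz, hτ⟩, hmax⟩ := ((isCompact_closedBall x₀ R).prod isCompact_Icc).exists_isMaxOn
    ⟨(z₁, τ₁), hz₁, hτ₁⟩ ((hu.mono hK).sub hφc)
  simp only at hz hτ
  have key : u (z, τ) < φ (z, τ) := by
    by_cases hb : ‖z - x₀‖ = R ∨ τ = s ∨ τ = T
    · exact hbd z hz τ hτ hb
    exfalso
    push Not at hb
    have hz' : z ∈ ball x₀ R := by
      rw [mem_ball_iff_norm]; rw [mem_closedBall_iff_norm] at hz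
      exact lt_of_le_of_ne hz hb.1
    have hτ' : τ ∈ Ioo s T := ⟨lt_of_le_of_ne hτ.1 hb.2.1.symm, lt_of_le_of_ne hτ.2 hb.2.2⟩
    have hnh : closedBall x₀ R ×ˢ Icc s T ∈ 𝓝 (z, τ) :=
      prod_mem_nhds (closedBall_mem_nhds_of_mem hz') (Icc_mem_nhds hτ'.1 hτ'.2)
    have hloc : IsLocalMaxOn (fun w => u w - φ w) O (z, τ) :=
      (hmax.isLocalMax hnh).on O
    have := hsub φ z τ (hK ⟨hz, hτ⟩) (hφ z τ hτ) hloc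
    exact absurd (hint z τ hτ (hK ⟨hz, hτ⟩)) (not_lt.2 this)
  have h2 : u (z₁, τ₁) - φ (z₁, τ₁) ≤ u (z, τ) - φ (z, τ) := hmax ⟨hz₁, hτ₁⟩
  linarith

theorem IsViscositySupersolution.lt_of_strict_subsolution {N : ℕ}
    {O : Set (EuclideanSpace ℝ (Fin N) × ℝ)}
    {H : EuclideanSpace ℝ (Fin N) → ℝ → EuclideanSpace ℝ (Fin N) → ℝ}
    {u φ : EuclideanSpace ℝ (Fin N) × ℝ → ℝ} (hsuper : IsViscositySupersolution O H u)
    (hu : ContinuousOn u O) {x₀ : EuclideanSpace ℝ (Fin N)} {R s T : ℝ}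
    (hK : closedBall x₀ R ×ˢ Icc s T ⊆ O)
    (hφ : ∀ z, ∀ τ ∈ Icc s T, ContDiffAt ℝ 1 φ (z, τ))
    (hbd : ∀ z ∈ closedBall x₀ R, ∀ τ ∈ Icc s T, (‖z - x₀‖ = R ∨ τ = s ∨ τ = T) →
      φ (z, τ) < u (z, τ))
    (hint : ∀ z, ∀ τ ∈ Icc s T, (z, τ) ∈ O →
      deriv (fun r => φ (z, r)) τ + H z τ (gradient (fun y => φ (y, τ)) z) < 0) :
    ∀ z ∈ closedBall x₀ R, ∀ τ ∈ Icc s T, φ (z, τ) < u (z, τ) := by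
  intro z₁ hz₁ τ₁ hτ₁
  have hφc : ContinuousOn φ (closedBall x₀ R ×ˢ Icc s T) := fun w hw =>
    (hφ w.1 w.2 hw.2).continuousAt.continuousWithinAt
  obtain ⟨⟨z, τ⟩, ⟨hz, hτ⟩, hmin⟩ := ((isCompact_closedBall x₀ R).prod isCompact_Icc).exists_isMinOn
    ⟨(z₁, τ₁), hz₁, hτ₁⟩ ((hu.mono hK).sub hφc)
  simp only at hz hτ
  have key : φ (z, τ) < u (z, τ) := by
    by_cases hb : ‖z - x₀‖ = R ∨ τ = s ∨ τ = T
    · exact hbd z hz τ hτ hb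
    exfalso
    push Not at hb
    have hz' : z ∈ ball x₀ R := by
      rw [mem_ball_iff_norm]; rw [mem_closedBall_iff_norm] at hz
      exact lt_of_le_of_ne hz hb.1
    have hτ' : τ ∈ Ioo s T := ⟨lt_of_le_of_ne hτ.1 hb.2.1.symm, lt_of_le_of_ne hτ.2 hb.2.2⟩
    have hnh : closedBall x₀ R ×ˢ Icc s T ∈ 𝓝 (z, τ) :=
      prod_mem_nhds (closedBall_mem_nhds_of_mem hz') (Icc_mem_nhds hτ'.1 hτ'.2)
    have hloc : IsLocalMinOn (fun w => u w - φ w) O (z, τ) :=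
      (hmin.isLocalMin hnh).on O
    have := hsuper φ z τ (hK ⟨hz, hτ⟩) (hφ z τ hτ) hloc
    exact absurd (hint z τ hτ (hK ⟨hz, hτ⟩)) (not_lt.2 this)
  have h2 : u (z, τ) - φ (z, τ) ≤ u (z₁, τ₁) - φ (z₁, τ₁) := hmin ⟨hz₁, hτ₁⟩
  linarith

/-! ### Lower growth bound: a backward almost-optimal point -/

/-- If every `y` violated the conclusion, `u` would lie above a concave barrier at time `t - h`, hence
above it at `(x, t)`, where the barrier equals `u`. The weight of the barrier is `2 h` at the initial
time and `h` at time `t`, which costs the factor `2 ^ (1 - p)`. The assumption `hsmall` puts the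
barrier below `-M` on the lateral boundary. -/
theorem IsViscositySupersolution.exists_backward_point {N : ℕ} {p q δ η M c R h : ℝ}
    (hpq : p.HolderConjugate q) (hη : 0 ≤ η) (hM : 0 ≤ M) (hc : 0 < c)
    (hcδ : δ * (p * c) ^ q ≤ c * (p - 1)) (hR : 0 < R) (hh : 0 < h)
    (hsmall : 2 * M + (η + 1) * h ≤ c * R ^ p * (2 * h) ^ (1 - p))
    {O : Set (EuclideanSpace ℝ (Fin N) × ℝ)}
    {H : EuclideanSpace ℝ (Fin N) → ℝ → EuclideanSpace ℝ (Fin N) → ℝ}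
    {u : EuclideanSpace ℝ (Fin N) × ℝ → ℝ} (hsuper : IsViscositySupersolution O H u)
    (hu : ContinuousOn u O) (huM : ∀ z ∈ O, |u z| ≤ M)
    (hH : ∀ x t z, (x, t) ∈ O → H x t z ≤ δ * ‖z‖ ^ q + η)
    {x : EuclideanSpace ℝ (Fin N)} {t : ℝ}
    (hK : closedBall x R ×ˢ Icc (t - h) (t + h) ⊆ O) :
    ∃ y ∈ closedBall x R,
      u (y, t - h) + c * 2 ^ (1 - p) * (‖x - y‖ ^ p * h ^ (1 - p)) - (η + 1) * h ≤ u (x, t) := by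
  have hp := hpq.pos
  have hp1 := hpq.sub_one_pos
  by_contra! hcon
  -- the term `-h exp (L (τ - t))` below is harmless up to time `t` but, for this `L`, pushes the
  -- barrier below `-M` at time `t + h / 2`
  set L : ℝ := 2 / h * (2 * M / h) + 1 with hL
  have hL0 : 0 < L := by positivity
  have hK' : closedBall x R ×ˢ Icc (t - h) (t + h / 2) ⊆ O :=
    (prod_mono_right (Icc_subset_Icc_right (by linarith))).trans hK
  set a := u (x, t) with ha
  have haM : |a| ≤ M := huM _ (hK ⟨mem_closedBall_self hR.le, by constructor <;> linarith⟩)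
  have ha1 := (abs_le.1 haM).2
  have ha2 := (abs_le.1 haM).1
  set g : ℝ → ℝ := fun τ => a + h - h * Real.exp (L * (τ - t)) + η * (t - τ) with hg
  set k : ℝ → ℝ := fun τ => -(c * (h + (t - τ)) ^ (1 - p)) with hk
  have hm : ∀ τ ∈ Icc (t - h) (t + h / 2), 0 < h + (t - τ) := fun τ hτ => by
    have := hτ.2; linarith
  have hg' : ∀ τ, HasDerivAt g (-(h * (Real.exp (L * (τ - t)) * L)) - η) τ := fun τ => by
    have h1 : HasDerivAt (fun τ => L * (τ - t)) L τ := by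
      simpa using ((hasDerivAt_id τ).sub_const t).const_mul L
    have h2 := (h1.exp.const_mul h).const_sub (a + h)
    have h3 : HasDerivAt (fun τ => η * (t - τ)) (-η) τ := by
      simpa using ((hasDerivAt_id τ).const_sub t).const_mul η
    exact (h2.add h3).congr_deriv (by ring)
  have hk' : ∀ τ ∈ Icc (t - h) (t + h / 2),
      HasDerivAt k (-(c * ((p - 1) * (h + (t - τ)) ^ (-p)))) τ := fun τ hτ => by
    have h1 : HasDerivAt (fun τ => h + (t - τ)) (-1) τ :=
      ((hasDerivAt_id τ).const_sub t).const_add h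
    have h2 := ((h1.rpow_const (p := 1 - p) (Or.inl (hm τ hτ).ne')).const_mul c).neg
    refine h2.congr_deriv ?_
    rw [show 1 - p - 1 = -p by ring]; ring
  have key := hsuper.lt_of_strict_subsolution (x₀ := x) (R := R) (s := t - h) (T := t + h / 2)
    (φ := fun w => g w.2 + k w.2 * ‖w.1 - x‖ ^ p) hu hK' ?_ ?_ ?_ x
    (mem_closedBall_self hR.le) t (by constructor <;> linarith)
  · simp only [sub_self, norm_zero, Real.zero_rpow hp.ne', mul_zero, add_zero, hg, Real.exp_zero,
      mul_one] at key
    linarith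
  · intro z τ hτ
    refine contDiffAt_add_mul_norm_rpow hpq.lt ?_ ?_ x z
    · exact ContDiff.contDiffAt (by fun_prop)
    · refine (contDiffAt_const.mul (ContDiffAt.rpow_const_of_ne
        (f := fun τ => h + (t - τ)) (by fun_prop) (hm τ hτ).ne')).neg
  · intro z hz τ hτ hb
    have hzO : (z, τ) ∈ O := hK' ⟨hz, hτ⟩
    have hu1 := (abs_le.1 (huM _ hzO)).1
    have hkn : k τ * ‖z - x‖ ^ p ≤ 0 := by
      have := hm τ hτ
      simp only [hk, neg_mul, neg_nonpos]; positivity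
    have hητ : η * (t - τ) ≤ η * h := mul_le_mul_of_nonneg_left (by linarith [hτ.1]) hη
    have hexp : 0 < h * Real.exp (L * (τ - t)) := by positivity
    -- the weight `m ^ (1 - p)` is smallest at the initial time, where `m = 2 h`
    have hmon : (2 * h) ^ (1 - p) ≤ (h + (t - τ)) ^ (1 - p) :=
      Real.rpow_le_rpow_of_nonpos (hm τ hτ) (by linarith [hτ.1]) (by linarith)
    simp only [hg]
    rcases hb with hb | rfl | rfl
    · have : c * R ^ p * (2 * h) ^ (1 - p) ≤ -(k τ * ‖z - x‖ ^ p) := by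
        simp only [hk, hb, neg_mul, neg_neg]
        have := mul_le_mul_of_nonneg_left hmon (show 0 ≤ c * R ^ p by positivity)
        linarith
      linarith
    · have h1 := hcon z hz
      have h2 : (2 * h) ^ (1 - p) = 2 ^ (1 - p) * h ^ (1 - p) :=
        Real.mul_rpow (by norm_num) hh.le
      have h3 : k (t - h) * ‖z - x‖ ^ p
          = -(c * 2 ^ (1 - p) * (‖x - z‖ ^ p * h ^ (1 - p))) := by
        simp only [hk]
        rw [show h + (t - (t - h)) = 2 * h by ring, h2, norm_sub_rev]; ring
      rw [h3]
      have h4 : η * (t - (t - h)) = η * h := by ring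
      rw [h4]
      linarith
    · have h1 : 1 + L * (t + h / 2 - t) ≤ Real.exp (L * (t + h / 2 - t)) := by
        linarith [Real.add_one_le_exp (L * (t + h / 2 - t))]
      have h2 := mul_le_mul_of_nonneg_left h1 hh.le
      have h3 : h * (1 + L * (t + h / 2 - t)) = h + 2 * M + h * (h / 2) := by
        rw [hL]; field_simp; ring
      have h4 : η * (t - (t + h / 2)) ≤ 0 := by
        have := mul_nonneg hη hh.le
        linarith
      have h5 : 0 < h * (h / 2) := by positivity
      linarith
  · intro z τ hτ hzO
    have hm' := hm τ hτ
    set m := h + (t - τ) with hmdef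
    have hkτ : k τ = -(c * m ^ (1 - p)) := rfl
    simp only
    rw [deriv_add_mul_const (hg' τ) (hk' τ hτ)]
    have h1 := hH z τ (gradient (fun y => g τ + k τ * ‖y - x‖ ^ p) z) hzO
    rw [norm_gradient_const_add_mul_norm_rpow hpq.lt, hkτ, abs_neg, abs_of_nonneg (by positivity),
      slope_rpow_eq hpq hc.le hm' (norm_nonneg _)] at h1
    have h2 : 0 ≤ m ^ (-p) * ‖z - x‖ ^ p := by positivity
    have h3 := mul_le_mul_of_nonneg_right hcδ h2
    have h4 : 0 < h * (Real.exp (L * (τ - t)) * L) := by positivity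
    rw [hkτ]
    simp only [← hmdef]
    linarith

/-! ### Upper growth bound -/

/-- Comparison with a barrier that is almost singular at `(y, s)`. The assumption `hsmall` puts the
barrier above `M` on the lateral boundary. -/
theorem IsViscositySubsolution.le_add_rpow {N : ℕ} {p q δ η M C R h : ℝ}
    (hpq : p.HolderConjugate q) (hη : 0 ≤ η) (hM : 0 ≤ M) (hC : 0 < C)
    (hCδ : C * (p - 1) ≤ 1 / δ * (p * C) ^ q) (hR : 0 < R) (hh : 0 < h)
    (hsmall : 2 * M ≤ C * R ^ p * (2 * h) ^ (1 - p))
    {O : Set (EuclideanSpace ℝ (Fin N) × ℝ)}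
    {H : EuclideanSpace ℝ (Fin N) → ℝ → EuclideanSpace ℝ (Fin N) → ℝ}
    {u : EuclideanSpace ℝ (Fin N) × ℝ → ℝ} (hsub : IsViscositySubsolution O H u)
    (hu : ContinuousOn u O) (huM : ∀ z ∈ O, |u z| ≤ M)
    (hH : ∀ x t z, (x, t) ∈ O → 1 / δ * ‖z‖ ^ q - η ≤ H x t z)
    {y : EuclideanSpace ℝ (Fin N)} {s : ℝ}
    (hK : closedBall y R ×ˢ Icc s (s + 2 * h) ⊆ O)
    {x : EuclideanSpace ℝ (Fin N)} (hx : x ∈ closedBall y R) :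
    u (x, s + h) ≤ u (y, s) + C * (‖x - y‖ ^ p * h ^ (1 - p)) + (η + 1) * h := by
  have hp := hpq.pos
  have hp1 := hpq.sub_one_pos
  set σ : ℝ := h / 4 with hσ
  have hσ0 : 0 < σ := by positivity
  -- the term `σ exp (L (τ - s - h))` below is at most `σ` up to time `s + h` but, for this `L`, lifts
  -- the barrier above `M` at time `s + 3 h / 2`
  set L : ℝ := 2 / h * (2 * M / σ) + 1 with hL
  have hL0 : 0 < L := by positivity
  have hK' : closedBall y R ×ˢ Icc s (s + 3 / 2 * h) ⊆ O :=
    (prod_mono_right (Icc_subset_Icc_right (by linarith))).trans hK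
  set b := u (y, s) with hb_def
  have hyO : (y, s) ∈ O := hK ⟨mem_closedBall_self hR.le, by constructor <;> linarith⟩
  have hb2 := (abs_le.1 (huM _ hyO)).1
  -- at time `s` the barrier dominates `u` near `y` by continuity, and elsewhere because `ε` is small
  obtain ⟨r, hr0, hr⟩ : ∃ r > 0, ∀ z ∈ closedBall y R, ‖z - y‖ < r → u (z, s) < b + σ := by
    have h1 : ContinuousOn (fun z => u (z, s)) (closedBall y R) :=
      hu.comp (by fun_prop) fun z hz => hK ⟨hz, by constructor <;> linarith⟩
    obtain ⟨r, hr0, hr⟩ := Metric.continuousOn_iff.1 h1 y (mem_closedBall_self hR.le) σ hσ0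
    refine ⟨r, hr0, fun z hz hzr => ?_⟩
    have := hr z hz (by rwa [dist_eq_norm])
    rw [Real.dist_eq] at this
    linarith [(abs_lt.1 this).2]
  obtain ⟨ε, hε0, hεh, hε⟩ : ∃ ε > 0, ε ≤ h / 2 ∧ 2 * M ≤ C * r ^ p * ε ^ (1 - p) := by
    have h1 : Tendsto (fun ε : ℝ => C * r ^ p * ε ^ (1 - p)) (𝓝[>] 0) atTop :=
      (tendsto_rpow_neg_nhdsGT_zero (by linarith)).const_mul_atTop (by positivity)
    have h2 : ∀ᶠ ε in 𝓝[>] (0 : ℝ), ε ≤ h / 2 :=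
      nhdsWithin_le_nhds (Iic_mem_nhds (by positivity))
    obtain ⟨ε, ⟨h3, h4⟩, h5⟩ :=
      (((h1.eventually_ge_atTop (2 * M)).and h2).and self_mem_nhdsWithin).exists
    exact ⟨ε, h5, h4, h3⟩
  set t := s + h with ht
  set g : ℝ → ℝ := fun τ => b + σ + σ * Real.exp (L * (τ - t)) + η * (τ - s) with hg
  set k : ℝ → ℝ := fun τ => C * (ε + (τ - s)) ^ (1 - p) with hk
  have hm : ∀ τ ∈ Icc s (s + 3 / 2 * h), 0 < ε + (τ - s) := fun τ hτ => by
    have := hτ.1; linarith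
  have hg' : ∀ τ, HasDerivAt g (σ * (Real.exp (L * (τ - t)) * L) + η) τ := fun τ => by
    have h1 : HasDerivAt (fun τ => L * (τ - t)) L τ := by
      simpa using ((hasDerivAt_id τ).sub_const t).const_mul L
    have h2 := (h1.exp.const_mul σ).const_add (b + σ)
    have h3 : HasDerivAt (fun τ => η * (τ - s)) η τ := by
      simpa using ((hasDerivAt_id τ).sub_const s).const_mul η
    exact h2.add h3
  have hk' : ∀ τ ∈ Icc s (s + 3 / 2 * h),
      HasDerivAt k (-(C * ((p - 1) * (ε + (τ - s)) ^ (-p)))) τ := fun τ hτ => by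
    have h1 : HasDerivAt (fun τ => ε + (τ - s)) 1 τ :=
      ((hasDerivAt_id τ).sub_const s).const_add ε
    have h2 := (h1.rpow_const (p := 1 - p) (Or.inl (hm τ hτ).ne')).const_mul C
    refine h2.congr_deriv ?_
    rw [show 1 - p - 1 = -p by ring]; ring
  have key := hsub.lt_of_strict_supersolution (x₀ := y) (R := R) (s := s) (T := s + 3 / 2 * h)
    (φ := fun w => g w.2 + k w.2 * ‖w.1 - y‖ ^ p) hu hK' ?_ ?_ ?_ x hx t
    (by constructor <;> linarith)
  · simp only [hg, hk, sub_self, mul_zero, Real.exp_zero, mul_one] at key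
    have h1 : t - s = h := by rw [ht]; ring
    rw [h1] at key
    have h2 : (ε + h) ^ (1 - p) ≤ h ^ (1 - p) :=
      Real.rpow_le_rpow_of_nonpos hh (by linarith) (by linarith)
    have h3 := mul_le_mul_of_nonneg_left h2 (show 0 ≤ C * ‖x - y‖ ^ p by positivity)
    linarith
  · intro z τ hτ
    refine contDiffAt_add_mul_norm_rpow hpq.lt ?_ ?_ y z
    · exact ContDiff.contDiffAt (by fun_prop)
    · exact contDiffAt_const.mul (ContDiffAt.rpow_const_of_ne (by fun_prop) (hm τ hτ).ne')
  · intro z hz τ hτ hb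
    have hzO : (z, τ) ∈ O := hK' ⟨hz, hτ⟩
    have hu1 := (abs_le.1 (huM _ hzO)).2
    have hkn : 0 ≤ k τ * ‖z - y‖ ^ p := by
      have := hm τ hτ
      simp only [hk]; positivity
    have hητ : 0 ≤ η * (τ - s) := mul_nonneg hη (by linarith [hτ.1])
    have hexp : 0 < σ * Real.exp (L * (τ - t)) := by positivity
    simp only [hg]
    rcases hb with hb | rfl | rfl
    · have hmon : (2 * h) ^ (1 - p) ≤ (ε + (τ - s)) ^ (1 - p) :=
        Real.rpow_le_rpow_of_nonpos (hm τ hτ) (by linarith [hτ.2]) (by linarith)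
      have : C * R ^ p * (2 * h) ^ (1 - p) ≤ k τ * ‖z - y‖ ^ p := by
        simp only [hk, hb]
        have := mul_le_mul_of_nonneg_left hmon (show 0 ≤ C * R ^ p by positivity)
        linarith
      linarith
    · by_cases hzr : ‖z - y‖ < r
      · linarith [hr z hz hzr]
      · have h1 : r ^ p ≤ ‖z - y‖ ^ p := Real.rpow_le_rpow hr0.le (not_lt.1 hzr) hp.le
        have h2 : k τ = C * ε ^ (1 - p) := by simp [hk]
        have h3 := mul_le_mul_of_nonneg_left h1 (show 0 ≤ C * ε ^ (1 - p) by positivity)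
        rw [h2]
        linarith
    · have h1 : 1 + L * (s + 3 / 2 * h - t) ≤ Real.exp (L * (s + 3 / 2 * h - t)) := by
        linarith [Real.add_one_le_exp (L * (s + 3 / 2 * h - t))]
      have h2 := mul_le_mul_of_nonneg_left h1 hσ0.le
      have h3 : σ * (1 + L * (s + 3 / 2 * h - t)) = σ + 2 * M + σ * (h / 2) := by
        rw [hL, ht]; field_simp; ring
      have h5 : 0 < σ * (h / 2) := by positivity
      linarith
  · intro z τ hτ hzO
    have hm' := hm τ hτ
    set m := ε + (τ - s) with hmdef
    have hkτ : k τ = C * m ^ (1 - p) := rfl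
    simp only
    rw [deriv_add_mul_const (hg' τ) (hk' τ hτ)]
    have h1 := hH z τ (gradient (fun x => g τ + k τ * ‖x - y‖ ^ p) z) hzO
    rw [norm_gradient_const_add_mul_norm_rpow hpq.lt, hkτ, abs_of_nonneg (by positivity),
      slope_rpow_eq hpq hC.le hm' (norm_nonneg _)] at h1
    have h2 : 0 ≤ m ^ (-p) * ‖z - y‖ ^ p := by positivity
    have h3 := mul_le_mul_of_nonneg_right hCδ h2
    have h4 : 0 < σ * (Real.exp (L * (τ - t)) * L) := by positivity
    rw [hkτ]
    simp only [← hmdef]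
    linarith

/-! ### Energy decay -/

/-- Energies add up along consecutive time steps: the discrete form of Hölder's inequality
`(∫ |ξ'|) ^ p ≤ h ^ (p - 1) ∫ |ξ'| ^ p`. -/
theorem add_rpow_le_mul_of_rpow_le {p α β h k g e : ℝ} (hp : 1 ≤ p) (hα : 0 ≤ α) (hβ : 0 ≤ β)
    (hh : 0 < h) (hk : 0 < k) (h1 : α ^ p ≤ h ^ (p - 1) * g) (h2 : β ^ p ≤ k ^ (p - 1) * e) :
    (α + β) ^ p ≤ (h + k) ^ (p - 1) * (g + e) := by
  have key := (convexOn_rpow hp).2 (show α / h ∈ Ici 0 from div_nonneg hα hh.le)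
    (show β / k ∈ Ici 0 from div_nonneg hβ hk.le) (show 0 ≤ h / (h + k) by positivity)
    (show 0 ≤ k / (h + k) by positivity) (by field_simp)
  simp only [smul_eq_mul] at key
  have e0 : h / (h + k) * (α / h) + k / (h + k) * (β / k) = (α + β) / (h + k) := by
    field_simp
  have aux : ∀ {r s v : ℝ}, 0 ≤ r → 0 < s → r ^ p ≤ s ^ (p - 1) * v →
      s / (h + k) * (r / s) ^ p ≤ v / (h + k) := by
    intro r s v hr hs hv
    rw [Real.div_rpow hr hs.le, div_mul_eq_mul_div]
    refine div_le_div_of_nonneg_right ?_ (by positivity)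
    rw [mul_div_assoc', div_le_iff₀ (by positivity)]
    calc s * r ^ p ≤ s * (s ^ (p - 1) * v) := by gcongr
      _ = v * s ^ p := by
        have : s ^ p = s * s ^ (p - 1) := by
          rw [← Real.rpow_one_add' hs.le (by linarith)]; congr 1; ring
        rw [this]; ring
  have h3 := (key.trans (add_le_add (aux hα hh h1) (aux hβ hk h2)))
  rw [e0, Real.div_rpow (by positivity) (by positivity), ← add_div,
    div_le_iff₀ (by positivity)] at h3
  have : (h + k) ^ p = (h + k) * (h + k) ^ (p - 1) := by
    rw [← Real.rpow_one_add' (by positivity) (by linarith)]; congr 1; ring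
  rw [this] at h3
  calc _ ≤ _ := h3
    _ = _ := by field_simp

theorem add_rpow_le_two_rpow_mul {p α β X : ℝ} (hp : 0 ≤ p) (hα : 0 ≤ α) (hβ : 0 ≤ β)
    (h1 : α ^ p ≤ X) (h2 : β ^ p ≤ X) : (α + β) ^ p ≤ 2 ^ p * X := by
  have aux : ∀ {r s : ℝ}, 0 ≤ r → r ≤ s → s ^ p ≤ X → (r + s) ^ p ≤ 2 ^ p * X := by
    intro r s hr hrs hs
    calc (r + s) ^ p ≤ (2 * s) ^ p := Real.rpow_le_rpow (by linarith) (by linarith) hp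
      _ = 2 ^ p * s ^ p := Real.mul_rpow (by norm_num) (by linarith)
      _ ≤ 2 ^ p * X := by gcongr
  rcases le_total α β with h | h
  · exact aux hα h h2
  · rw [add_comm]; exact aux hβ h h1

/-- The point `(x, t)` reaches time `t - h`, inside the ball of radius `R` about `x`, by paying the
energy `g`: the value of `u` drops by at least `a g`, up to `B h`, and the displacement is the one
that energy `g` allows. For the minimizers of a calculus of variations problem `g` is the integral
of `|ξ'| ^ p`, and the second condition is Hölder's inequality. -/
def ReachesWithEnergy {E : Type*} [NormedAddCommGroup E] (p a B R : ℝ) (u : E × ℝ → ℝ)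
    (x : E) (t h g : ℝ) : Prop :=
  ∃ z ∈ closedBall x R, u (z, t - h) + a * g - B * h ≤ u (x, t) ∧ ‖x - z‖ ^ p ≤ h ^ (p - 1) * g

section

variable {E : Type*} [NormedAddCommGroup E] {p a A B M R h₁ : ℝ} {u : E × ℝ → ℝ} {x : E} {t : ℝ}

theorem ReachesWithEnergy.energy_le (ha : 0 < a) (hB : 0 ≤ B) (hR : 0 ≤ R) (hh₁ : h₁ ≤ 1)
    (huM : ∀ z ∈ closedBall x R, ∀ τ ∈ Icc (t - h₁) t, |u (z, τ)| ≤ M) {h g : ℝ}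
    (hh : 0 ≤ h) (hhh : h ≤ h₁) (hg : ReachesWithEnergy p a B R u x t h g) :
    g ≤ (2 * M + B) / a := by
  obtain ⟨z, hz, h1, -⟩ := hg
  have h2 := (abs_le.1 (huM z hz (t - h) (by constructor <;> linarith))).1
  have h3 := (abs_le.1 (huM x (mem_closedBall_self hR) t (by constructor <;> linarith))).2
  rw [le_div_iff₀ ha]
  nlinarith

/-- A step to a larger scale multiplies the energy by `1 + γ`, unless the energy was already linear
in `h`. -/
theorem ReachesWithEnergy.exists_step (hp : 1 < p) (ha : 0 < a) (hA : 0 ≤ A) (hB : 0 ≤ B)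
    (hR : 0 < R) (hh₁ : h₁ ≤ 1) (hRh : h₁ ^ (p - 1) * ((2 * M + B) / a) ≤ R ^ p)
    (huM : ∀ z ∈ closedBall x (2 * R), ∀ τ ∈ Icc (t - h₁) t, |u (z, τ)| ≤ M)
    (hupper : ∀ y ∈ closedBall x R, ∀ h, 0 < h → h ≤ h₁ →
      u (x, t) ≤ u (y, t - h) + A * (‖x - y‖ ^ p * h ^ (1 - p)) + B * h)
    (hlower : ∀ z ∈ closedBall x R, ∀ h k, 0 ≤ h → 0 < k → h + k ≤ h₁ → ∃ y ∈ closedBall z R,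
      u (y, t - h - k) + a * (‖z - y‖ ^ p * k ^ (1 - p)) - B * k ≤ u (z, t - h))
    {l γ : ℝ} (hl0 : 0 < l) (hl1 : l < 1) (hlγ : l ^ (p - 1) = γ)
    (hγA : A * (2 ^ p * γ) ≤ a / 2) {h g : ℝ} (hh : 0 < h) (hhl : h / l ≤ h₁) (hg0 : 0 ≤ g)
    (hg : ReachesWithEnergy p a B R u x t h g) :
    ∃ g', 0 ≤ g' ∧ ReachesWithEnergy p a B R u x t (h / l) g' ∧
      ((1 + γ) * g ≤ g' ∨ g ≤ 4 * B / (a * l) * h) := by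
  obtain ⟨z, hz, hz1, hz2⟩ := hg
  set h' := h / l with hh'
  have hhh' : h < h' := by rw [hh', lt_div_iff₀ hl0]; nlinarith
  have hh'0 : 0 < h' := hh.trans hhh'
  obtain ⟨y, hy, hy1⟩ := hlower z hz h (h' - h) hh.le (by linarith) (by linarith)
  set k := h' - h with hk
  have hk0 : 0 < k := by linarith
  set e := ‖z - y‖ ^ p * k ^ (1 - p) with he
  have he0 : 0 ≤ e := by positivity
  have hte : t - h - k = t - h' := by rw [hk]; ring
  rw [hte] at hy1
  have hxy : ‖x - y‖ ≤ ‖x - z‖ + ‖z - y‖ := norm_sub_le_norm_sub_add_norm_sub x z y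
  have hye : ‖z - y‖ ^ p ≤ k ^ (p - 1) * e := by
    rw [he, mul_left_comm, ← Real.rpow_add hk0]; simp
  have hval : u (y, t - h') + a * (g + e) - B * h' ≤ u (x, t) := by
    have : B * h' = B * h + B * k := by rw [hk]; ring
    linarith
  have hdisp : ‖x - y‖ ^ p ≤ h' ^ (p - 1) * (g + e) := by
    have h1 := add_rpow_le_mul_of_rpow_le hp.le (norm_nonneg _) (norm_nonneg _) hh hk0 hz2 hye
    rw [show h + k = h' by rw [hk]; ring] at h1
    exact (Real.rpow_le_rpow (norm_nonneg _) hxy (by linarith)).trans h1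
  -- a priori bound on the total energy, which keeps the new point in the ball of radius `R`
  have hyR : y ∈ closedBall x R := by
    have hy2R : y ∈ closedBall x (2 * R) := by
      rw [mem_closedBall, dist_comm, dist_eq_norm]
      rw [mem_closedBall, dist_comm, dist_eq_norm] at hy hz
      linarith
    have h2 := (abs_le.1 (huM y hy2R (t - h') (by constructor <;> linarith))).1
    have h3 := (abs_le.1 (huM x (mem_closedBall_self (by linarith)) t
      (by constructor <;> linarith))).2
    have h4 : g + e ≤ (2 * M + B) / a := by
      rw [le_div_iff₀ ha]; nlinarith
    have h5 : ‖x - y‖ ^ p ≤ R ^ p := by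
      refine hdisp.trans (le_trans ?_ hRh)
      have : h' ^ (p - 1) ≤ h₁ ^ (p - 1) := Real.rpow_le_rpow hh'0.le hhl (by linarith)
      exact mul_le_mul this h4 (by positivity) (by have := hh'0.trans_le hhl; positivity)
    rw [mem_closedBall, dist_comm, dist_eq_norm]
    exact (Real.rpow_le_rpow_iff (norm_nonneg _) hR.le (by linarith)).1 h5
  refine ⟨g + e, by positivity, ⟨y, hyR, hval, hdisp⟩, ?_⟩
  by_cases hcase : γ * g ≤ e
  · left; linarith
  right
  push Not at hcase
  -- with little energy spent on the new step the displacement is too small for the total energy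
  have hX1 : ‖x - z‖ ^ p ≤ h' ^ (p - 1) * (γ * g) := by
    have : h = l * h' := by rw [hh']; field_simp
    rw [this, Real.mul_rpow hl0.le hh'0.le, hlγ] at hz2
    linarith
  have hX2 : ‖z - y‖ ^ p ≤ h' ^ (p - 1) * (γ * g) := by
    refine hye.trans (mul_le_mul ?_ hcase.le he0 (by positivity))
    exact Real.rpow_le_rpow hk0.le (by linarith) (by linarith)
  have h6 := add_rpow_le_two_rpow_mul (by linarith) (norm_nonneg _) (norm_nonneg _) hX1 hX2
  have h7 : ‖x - y‖ ^ p ≤ 2 ^ p * (h' ^ (p - 1) * (γ * g)) :=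
    (Real.rpow_le_rpow (norm_nonneg _) hxy (by linarith)).trans h6
  have h8 := hupper y hyR h' hh'0 hhl
  have h9 : ‖x - y‖ ^ p * h' ^ (1 - p) ≤ 2 ^ p * γ * g := by
    calc ‖x - y‖ ^ p * h' ^ (1 - p)
        ≤ 2 ^ p * (h' ^ (p - 1) * (γ * g)) * h' ^ (1 - p) := by gcongr
      _ = 2 ^ p * γ * g * (h' ^ (p - 1) * h' ^ (1 - p)) := by ring
      _ = 2 ^ p * γ * g := by rw [← Real.rpow_add hh'0]; simp
  have h10 : A * (‖x - y‖ ^ p * h' ^ (1 - p)) ≤ a / 2 * g := by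
    calc _ ≤ A * (2 ^ p * γ * g) := by gcongr
      _ = A * (2 ^ p * γ) * g := by ring
      _ ≤ _ := by gcongr
  have h11 : a / 2 * g ≤ 2 * (B * h') := by nlinarith
  have h12 : 4 * B / (a * l) * h = 4 * (B * h') / a := by rw [hh']; field_simp
  rw [h12, le_div_iff₀ ha]
  linarith

end

/-- Energy decay. The exponent `β` is chosen before the top scale `h₁`, hence depends only on `p`, `a`
and `A`. -/
theorem exists_energy_decay_exponent (E : Type*) [NormedAddCommGroup E] {p a A B M : ℝ}
    (hp : 1 < p) (ha : 0 < a) (haA : a ≤ A) (hB : 0 ≤ B) (hM : 0 ≤ M) :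
    ∃ β : ℝ, 0 < β ∧ β < 1 ∧ ∀ h₁ : ℝ, 0 < h₁ → h₁ ≤ 1 → ∃ D : ℝ, 0 ≤ D ∧
      ∀ (R : ℝ) (u : E × ℝ → ℝ) (x : E) (t : ℝ), 0 < R →
        h₁ ^ (p - 1) * ((2 * M + B) / a) ≤ R ^ p →
        (∀ z ∈ closedBall x (2 * R), ∀ τ ∈ Icc (t - h₁) t, |u (z, τ)| ≤ M) →
        (∀ y ∈ closedBall x R, ∀ h, 0 < h → h ≤ h₁ →
          u (x, t) ≤ u (y, t - h) + A * (‖x - y‖ ^ p * h ^ (1 - p)) + B * h) →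
        (∀ z ∈ closedBall x R, ∀ h k, 0 ≤ h → 0 < k → h + k ≤ h₁ → ∃ y ∈ closedBall z R,
          u (y, t - h - k) + a * (‖z - y‖ ^ p * k ^ (1 - p)) - B * k ≤ u (z, t - h)) →
        ∀ h, 0 < h → h ≤ h₁ → ∃ y ∈ closedBall x R,
          u (y, t - h) ≤ u (x, t) + B * h ∧ ‖x - y‖ ^ p ≤ D * h ^ (p - 1 + β) := by
  have hA : 0 < A := ha.trans_le haA
  -- `γ` is small enough for the step lemma, and `l` is the ratio of scales with `l ^ (p - 1) = γ`
  set γ : ℝ := a / (2 * A * 2 ^ p) with hγ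
  have h2p : (2 : ℝ) ≤ 2 ^ p := by
    simpa using Real.rpow_le_rpow_of_exponent_le (show (1 : ℝ) ≤ 2 by norm_num) hp.le
  have hγ0 : 0 < γ := by positivity
  have hγ1 : γ < 1 := by
    rw [hγ, div_lt_one (by positivity)]; nlinarith
  have hγA : A * (2 ^ p * γ) ≤ a / 2 := by
    rw [hγ]; apply le_of_eq; field_simp
  have hp1 : 0 < p - 1 := by linarith
  set l : ℝ := γ ^ (1 / (p - 1)) with hl
  have hl0 : 0 < l := by positivity
  have hl1 : l < 1 := Real.rpow_lt_one hγ0.le hγ1 (by positivity)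
  have hlγ : l ^ (p - 1) = γ := by
    rw [hl, ← Real.rpow_mul hγ0.le, one_div_mul_cancel hp1.ne', Real.rpow_one]
  obtain ⟨β, hβ0, hβ1, hβ⟩ : ∃ β : ℝ, 0 < β ∧ β < 1 ∧ 1 ≤ (1 + γ) * l ^ β := by
    have h1 : Tendsto (fun β : ℝ => (1 + γ) * l ^ β) (𝓝[>] 0) (𝓝 ((1 + γ) * l ^ (0 : ℝ))) := by
      refine Tendsto.const_mul _ (tendsto_nhdsWithin_of_tendsto_nhds ?_)
      exact (Real.continuous_const_rpow hl0.ne').tendsto 0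
    have h2 : (1 : ℝ) < (1 + γ) * l ^ (0 : ℝ) := by simp [hγ0]
    have h3 : ∀ᶠ β in 𝓝[>] (0 : ℝ), β < 1 := nhdsWithin_le_nhds (Iio_mem_nhds one_pos)
    obtain ⟨β, ⟨h4, h5⟩, h6⟩ := (((h1.eventually_const_le h2).and h3).and self_mem_nhdsWithin).exists
    exact ⟨β, h6, h5, h4⟩
  refine ⟨β, hβ0, hβ1, fun h₁ hh₁0 hh₁ => ?_⟩
  set D : ℝ := max ((2 * M + B) / a / (l * h₁) ^ β) (4 * B / (a * l)) with hD
  have hD0 : 0 ≤ D := le_max_of_le_right (by positivity)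
  refine ⟨D, hD0, fun R u x t hR hRh huM hupper hlower => ?_⟩
  have huM' : ∀ z ∈ closedBall x R, ∀ τ ∈ Icc (t - h₁) t, |u (z, τ)| ≤ M := fun z hz =>
    huM z (closedBall_subset_closedBall (by linarith) hz)
  have hlarge : ∀ h, l * h₁ ≤ h → h ≤ h₁ → ∀ g, ReachesWithEnergy p a B R u x t h g →
      g ≤ D * h ^ β := by
    intro h hlh hhh g hg
    have hlh0 : 0 < l * h₁ := by positivity
    have h1 := hg.energy_le ha hB hR.le hh₁ huM' (hlh0.le.trans hlh) hhh
    calc g ≤ (2 * M + B) / a / (l * h₁) ^ β * (l * h₁) ^ β := by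
          rw [div_mul_cancel₀]
          · exact h1
          · positivity
      _ ≤ D * h ^ β := by
          gcongr
          exact le_max_left _ _
  have hdecay : ∀ n : ℕ, ∀ h, l ^ n * h₁ ≤ h → h ≤ h₁ → ∀ g, 0 ≤ g →
      ReachesWithEnergy p a B R u x t h g → g ≤ D * h ^ β := by
    intro n
    induction n with
    | zero =>
      intro h hlh hhh g _ hg
      refine hlarge h (le_trans ?_ hlh) hhh g hg
      simp only [pow_zero]; gcongr
    | succ n ih =>
      intro h hlh hhh g hg0 hg
      by_cases hc : l * h₁ ≤ h
      · exact hlarge h hc hhh g hg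
      push Not at hc
      have hh0 : 0 < h := lt_of_lt_of_le (by positivity) hlh
      have hhl : h / l ≤ h₁ := by rw [div_le_iff₀ hl0]; linarith
      obtain ⟨g', hg'0, hg', hor⟩ := hg.exists_step hp ha hA.le hB hR hh₁ hRh huM hupper hlower
        hl0 hl1 hlγ hγA hh0 hhl hg0
      rcases hor with h1 | h1
      · have h2 := ih (h / l) (by rw [le_div_iff₀ hl0]; rw [pow_succ] at hlh; linarith) hhl g' hg'0 hg'
        rw [Real.div_rpow hh0.le hl0.le, mul_div_assoc', le_div_iff₀ (by positivity)] at h2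
        calc g ≤ g * ((1 + γ) * l ^ β) := le_mul_of_one_le_right hg0 hβ
          _ = (1 + γ) * g * l ^ β := by ring
          _ ≤ g' * l ^ β := by gcongr
          _ ≤ D * h ^ β := h2
      · have h2 : h ≤ h ^ β := by
          simpa using Real.rpow_le_rpow_of_exponent_ge hh0 (hhh.trans hh₁) hβ1.le
        calc g ≤ 4 * B / (a * l) * h := h1
          _ ≤ D * h ^ β := by
            gcongr
            exact le_max_right _ _
  intro h hh hhh
  obtain ⟨y, hy, hy1⟩ := hlower x (mem_closedBall_self hR.le) 0 h le_rfl hh (by linarith)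
  rw [sub_zero] at hy1
  set g := ‖x - y‖ ^ p * h ^ (1 - p) with hg
  have hg0 : 0 ≤ g := by positivity
  have hgeq : ‖x - y‖ ^ p = h ^ (p - 1) * g := by
    rw [hg, mul_left_comm, ← Real.rpow_add hh]; simp
  have hreach : ReachesWithEnergy p a B R u x t h g := ⟨y, hy, hy1, hgeq.le⟩
  obtain ⟨n, hn⟩ : ∃ n : ℕ, l ^ n < h / h₁ := exists_pow_lt_of_lt_one (by positivity) hl1
  have h1 := hdecay n h ((lt_div_iff₀ hh₁0).1 hn).le hhh g hg0 hreach
  refine ⟨y, hy, ?_, ?_⟩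
  · have := mul_nonneg ha.le hg0
    linarith
  · rw [hgeq, Real.rpow_add hh]
    calc h ^ (p - 1) * g ≤ h ^ (p - 1) * (D * h ^ β) := by gcongr
      _ = _ := by ring

/-! ### The one-sided modulus of continuity -/

theorem closedBall_prod_Icc_subset_of_mem_interiorRegion {N : ℕ}
    {O : Set (EuclideanSpace ℝ (Fin N) × ℝ)} {ρ : ℝ} (hρ : 0 < ρ) {x : EuclideanSpace ℝ (Fin N)}
    {t : ℝ} (h : (x, t) ∈ interiorRegion O ρ) :
    closedBall x (ρ / 2) ×ˢ Icc (t - ρ / 2) (t + ρ / 2) ⊆ O := by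
  rintro ⟨z, τ⟩ ⟨hz, hτ⟩
  by_contra hO
  simp only [mem_closedBall, mem_Icc] at hz hτ
  have h1 : infEDist (WithLp.toLp 2 (x, t)) (WithLp.toLp 2 '' Oᶜ)
      ≤ edist (WithLp.toLp 2 (x, t)) (WithLp.toLp 2 (z, τ)) :=
    infEDist_le_edist_of_mem (mem_image_of_mem _ hO)
  have h2 := h.2.trans_le h1
  rw [edist_dist, ENNReal.ofReal_lt_ofReal_iff_of_nonneg hρ.le,
    WithLp.prod_dist_eq_of_L2] at h2
  have h3 : dist x z ^ 2 ≤ (ρ / 2) ^ 2 := by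
    rw [dist_comm]; exact pow_le_pow_left₀ dist_nonneg hz 2
  have h4 : dist t τ ^ 2 ≤ (ρ / 2) ^ 2 := by
    rw [Real.dist_eq]
    exact pow_le_pow_left₀ (abs_nonneg _) (abs_le.2 ⟨by linarith [hτ.2], by linarith [hτ.1]⟩) 2
  have h5 : √(dist x z ^ 2 + dist t τ ^ 2) ≤ ρ :=
    Real.sqrt_le_iff.2 ⟨hρ.le, by nlinarith⟩
  exact absurd h2 (not_lt.2 h5)

/-- All the smallness conditions on the top scale `h₁`. -/
theorem exists_step_bound {p c K L R : ℝ} (hp : 1 < p) (hc : 0 < c) (hR : 0 < R) :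
    ∃ h₁ : ℝ, 0 < h₁ ∧ h₁ ≤ 1 ∧ h₁ ≤ R ∧ h₁ ^ (p - 1) * L ≤ R ^ p ∧ h₁ ^ (p - 1) ≤ R ^ p ∧
      K ≤ c * R ^ p * (3 * h₁) ^ (1 - p) := by
  have hp1 : 0 < p - 1 := by linarith
  have hRp : 0 < R ^ p := by positivity
  have h0 : Tendsto (fun h : ℝ => h ^ (p - 1)) (𝓝[>] 0) (𝓝 0) := by
    have := (Real.continuous_rpow_const hp1.le).tendsto 0
    rw [Real.zero_rpow hp1.ne'] at this
    exact tendsto_nhdsWithin_of_tendsto_nhds this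
  have h1 : Tendsto (fun h : ℝ => h ^ (p - 1) * L) (𝓝[>] 0) (𝓝 0) := by
    simpa using h0.mul_const L
  have h2 : Tendsto (fun h : ℝ => c * R ^ p * (3 * h) ^ (1 - p)) (𝓝[>] 0) atTop := by
    have h3 : Tendsto (fun h : ℝ => 3 * h) (𝓝[>] 0) (𝓝[>] 0) := by
      refine tendsto_nhdsWithin_of_tendsto_nhds_of_eventually_within _ ?_ ?_
      · refine tendsto_nhdsWithin_of_tendsto_nhds ?_
        simpa using (continuous_const_mul (3 : ℝ)).tendsto 0
      · filter_upwards [self_mem_nhdsWithin] with h hh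
        simpa using hh
    exact ((tendsto_rpow_neg_nhdsGT_zero (by linarith)).comp h3).const_mul_atTop (by positivity)
  have e1 : ∀ᶠ h in 𝓝[>] (0 : ℝ), h ≤ 1 := nhdsWithin_le_nhds (Iic_mem_nhds one_pos)
  have e2 : ∀ᶠ h in 𝓝[>] (0 : ℝ), h ≤ R := nhdsWithin_le_nhds (Iic_mem_nhds hR)
  have e3 : ∀ᶠ h in 𝓝[>] (0 : ℝ), 0 < h := self_mem_nhdsWithin
  obtain ⟨h, h3, h4, h5, h6, h7, h8⟩ := (e3.and (e1.and (e2.and ((h1.eventually_le_const hRp).and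
    ((h0.eventually_le_const hRp).and (h2.eventually_ge_atTop K)))))).exists
  exact ⟨h, h3, h4, h5, h6, h7, h8⟩

/-- Only `(x, t)` has to lie in the interior region; the Hölder estimate follows by exchanging the two
points. -/
theorem exists_one_sided_modulus (N : ℕ) {p q δ ηm ηp M : ℝ} (hpq : p.HolderConjugate q)
    (hδ : 0 < δ) (hηm : 0 ≤ ηm) (hηp : 0 ≤ ηp) (hM : 0 ≤ M) :
    ∃ β : ℝ, 0 < β ∧ β < 1 ∧ ∀ ρ : ℝ, 0 < ρ → ∃ h₁ C : ℝ, 0 < h₁ ∧ 0 ≤ C ∧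
      ∀ (O : Set (EuclideanSpace ℝ (Fin N) × ℝ))
        (H : EuclideanSpace ℝ (Fin N) → ℝ → EuclideanSpace ℝ (Fin N) → ℝ),
        (∀ x t z, (x, t) ∈ O → 1 / δ * ‖z‖ ^ q - ηm ≤ H x t z ∧ H x t z ≤ δ * ‖z‖ ^ q + ηp) →
      ∀ u : EuclideanSpace ℝ (Fin N) × ℝ → ℝ,
        IsViscositySolution O H u → (∀ z ∈ O, |u z| ≤ M) →
      ∀ (x x' : EuclideanSpace ℝ (Fin N)) (t t' h : ℝ), (x, t) ∈ interiorRegion O ρ →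
        0 < h → h ≤ h₁ → 2 * |t - t'| ≤ h → ‖x - x'‖ ^ p ≤ h ^ (p - 1 + β) →
        u (x', t') ≤ u (x, t) + C * h ^ β := by
  have hp := hpq.lt
  have hp0 := hpq.pos
  obtain ⟨c, hc0, hc1, hc⟩ := exists_pos_le_one_mul_rpow_le hpq hδ
  obtain ⟨A, hA1, hA⟩ := exists_one_le_mul_le_rpow hpq hδ
  have hA0 : 0 < A := by linarith
  set a : ℝ := c * 2 ^ (1 - p) with ha
  have ha0 : 0 < a := by positivity
  have haA : a ≤ A := by
    have : (2 : ℝ) ^ (1 - p) ≤ 1 := Real.rpow_le_one_of_one_le_of_nonpos (by norm_num) (by linarith)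
    nlinarith
  set B : ℝ := ηm + ηp + 1 with hB
  have hB0 : 0 ≤ B := by positivity
  obtain ⟨β, hβ0, hβ1, hβ⟩ := exists_energy_decay_exponent (EuclideanSpace ℝ (Fin N)) hp ha0 haA
    hB0 hM
  refine ⟨β, hβ0, hβ1, fun ρ hρ => ?_⟩
  set R : ℝ := ρ / 8 with hR
  have hR0 : 0 < R := by positivity
  obtain ⟨h₁, hh₁0, hh₁1, hh₁R, hh₁L, hh₁p, hh₁K⟩ :=
    exists_step_bound (K := 2 * M + 2 * B) (L := (2 * M + B) / a) hp hc0 hR0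
  obtain ⟨D, hD0, hD⟩ := hβ h₁ hh₁0 hh₁1
  refine ⟨h₁, 5 / 2 * B + A * (2 ^ p * (1 + D)) * (1 / 2) ^ (1 - p), hh₁0, by positivity, ?_⟩
  intro O H hH u hu huM x x' t t' h hx hh hhh₁ htt' hxx'
  have hsub := hu.subsolution
  have hsuper := hu.supersolution
  have huc := hu.continuousOn
  have hcyl : closedBall x (4 * R) ×ˢ Icc (t - 4 * R) (t + 4 * R) ⊆ O := by
    have := closedBall_prod_Icc_subset_of_mem_interiorRegion hρ hx
    rwa [show ρ / 2 = 4 * R by rw [hR]; ring] at this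
  have hcyl' : ∀ z r s s', r + dist z x ≤ 4 * R → t - 4 * R ≤ s → s' ≤ t + 4 * R →
      closedBall z r ×ˢ Icc s s' ⊆ O := fun z r s s' h1 h2 h3 =>
    (prod_mono (closedBall_subset_closedBall' h1) (Icc_subset_Icc h2 h3)).trans hcyl
  have hsmall : ∀ k, 0 < k → k ≤ 3 / 2 * h₁ → 2 * M + 2 * B ≤ c * R ^ p * (2 * k) ^ (1 - p) := by
    intro k hk hkh
    refine hh₁K.trans (mul_le_mul_of_nonneg_left ?_ (by positivity))
    exact Real.rpow_le_rpow_of_nonpos (by positivity) (by linarith) (by linarith)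
  have hupper : ∀ r, R ≤ r → ∀ y s k, 0 < k → k ≤ 3 / 2 * h₁ →
      closedBall y r ×ˢ Icc s (s + 2 * k) ⊆ O → ∀ z ∈ closedBall y r,
      u (z, s + k) ≤ u (y, s) + A * (‖z - y‖ ^ p * k ^ (1 - p)) + B * k := by
    intro r hr y s k hk hkh hK z hz
    have h1 : 2 * M ≤ A * r ^ p * (2 * k) ^ (1 - p) := by
      have h2 : c * R ^ p * (2 * k) ^ (1 - p) ≤ A * r ^ p * (2 * k) ^ (1 - p) := by
        have : R ^ p ≤ r ^ p := Real.rpow_le_rpow hR0.le hr hp0.le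
        gcongr
        linarith
      linarith [hsmall k hk hkh]
    have h2 := hsub.le_add_rpow hpq hηm hM hA0 hA (hR0.trans_le hr) hk h1 huc huM
      (fun x t z hxt => (hH x t z hxt).1) hK hz
    have h3 : (ηm + 1) * k ≤ B * k := mul_le_mul_of_nonneg_right (by linarith) hk.le
    linarith
  have hbound : ∀ z ∈ closedBall x (2 * R), ∀ τ ∈ Icc (t - h₁) t, |u (z, τ)| ≤ M := by
    intro z hz τ hτ
    refine huM _ (hcyl ⟨closedBall_subset_closedBall (by linarith) hz, ?_⟩)
    constructor <;> linarith [hτ.1, hτ.2]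
  have hup : ∀ y ∈ closedBall x R, ∀ k, 0 < k → k ≤ h₁ →
      u (x, t) ≤ u (y, t - k) + A * (‖x - y‖ ^ p * k ^ (1 - p)) + B * k := by
    intro y hy k hk hkh
    have h1 := hupper R le_rfl y (t - k) k hk (by linarith)
      (hcyl' _ _ _ _ (by linarith [mem_closedBall.1 hy]) (by linarith) (by linarith)) x
      (mem_closedBall_comm.1 hy)
    rwa [sub_add_cancel] at h1
  have hlow : ∀ z ∈ closedBall x R, ∀ k₁ k₂, 0 ≤ k₁ → 0 < k₂ → k₁ + k₂ ≤ h₁ →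
      ∃ y ∈ closedBall z R,
        u (y, t - k₁ - k₂) + a * (‖z - y‖ ^ p * k₂ ^ (1 - p)) - B * k₂ ≤ u (z, t - k₁) := by
    intro z hz k₁ k₂ hk₁ hk₂ hkk
    have h0 : 2 * M + (ηp + 1) * k₂ ≤ c * R ^ p * (2 * k₂) ^ (1 - p) := by
      have h2 := hsmall k₂ hk₂ (by linarith)
      have h3 : (ηp + 1) * k₂ ≤ (ηp + 1) * 1 := by gcongr; linarith
      linarith
    obtain ⟨y, hy, h1⟩ := hsuper.exists_backward_point hpq hηp hM hc0 hc hR0 hk₂ h0 huc huM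
      (fun x t z hxt => (hH x t z hxt).2) (x := z) (t := t - k₁)
      (hcyl' _ _ _ _ (by linarith [mem_closedBall.1 hz]) (by linarith) (by linarith))
    refine ⟨y, hy, ?_⟩
    have h3 : (ηp + 1) * k₂ ≤ B * k₂ := mul_le_mul_of_nonneg_right (by linarith) hk₂.le
    linarith
  obtain ⟨y, hy, hy1, hy2⟩ := hD R u x t hR0 hh₁L hbound hup hlow h hh hhh₁
  -- compare along the segment from `(y, t - h)` to `(x', t')`
  have htt := abs_le.1 (show |t - t'| ≤ h / 2 by linarith)
  set k := t' - (t - h) with hk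
  have hk1 : h / 2 ≤ k := by linarith [htt.2]
  have hk2 : k ≤ 3 / 2 * h := by linarith [htt.1]
  have hk0 : 0 < k := by linarith
  rw [mem_closedBall] at hy
  have hp1β : h ^ (p - 1 + β) ≤ R ^ p := by
    calc h ^ (p - 1 + β) ≤ h ^ (p - 1) :=
          Real.rpow_le_rpow_of_exponent_ge hh (by linarith) (by linarith)
      _ ≤ h₁ ^ (p - 1) := Real.rpow_le_rpow hh.le hhh₁ (by linarith)
      _ ≤ R ^ p := hh₁p
  have hxR : ‖x - x'‖ ≤ R :=
    (Real.rpow_le_rpow_iff (norm_nonneg _) hR0.le hp0).1 (hxx'.trans hp1β)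
  have hx'y : ‖x' - y‖ ≤ ‖x - x'‖ + ‖x - y‖ := by
    rw [norm_sub_rev x x']; exact norm_sub_le_norm_sub_add_norm_sub x' x y
  have hx'mem : x' ∈ closedBall y (2 * R) := by
    rw [mem_closedBall, dist_eq_norm]
    rw [dist_comm, dist_eq_norm] at hy
    linarith
  have h1 := hupper (2 * R) (by linarith) y (t - h) k hk0 (by linarith)
    (hcyl' _ _ _ _ (by linarith) (by linarith) (by linarith)) x' hx'mem
  rw [show t - h + k = t' by rw [hk]; ring] at h1
  have hX0 : 0 ≤ h ^ (p - 1 + β) := by positivity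
  have h2 : ‖x' - y‖ ^ p ≤ 2 ^ p * ((1 + D) * h ^ (p - 1 + β)) := by
    refine (Real.rpow_le_rpow (norm_nonneg _) hx'y hp0.le).trans ?_
    refine add_rpow_le_two_rpow_mul hp0.le (norm_nonneg _) (norm_nonneg _) ?_ ?_
    · nlinarith
    · linarith
  have h3 : k ^ (1 - p) ≤ (1 / 2) ^ (1 - p) * h ^ (1 - p) := by
    rw [← Real.mul_rpow (by norm_num) hh.le]
    exact Real.rpow_le_rpow_of_nonpos (by positivity) (by linarith) (by linarith)
  have h4 : A * (‖x' - y‖ ^ p * k ^ (1 - p))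
      ≤ A * (2 ^ p * (1 + D)) * (1 / 2) ^ (1 - p) * h ^ β := by
    calc A * (‖x' - y‖ ^ p * k ^ (1 - p))
        ≤ A * ((2 ^ p * ((1 + D) * h ^ (p - 1 + β))) * ((1 / 2) ^ (1 - p) * h ^ (1 - p))) := by
          gcongr
      _ = A * (2 ^ p * (1 + D)) * (1 / 2) ^ (1 - p) * (h ^ (p - 1 + β) * h ^ (1 - p)) := by ring
      _ = _ := by rw [← Real.rpow_add hh]; congr 2; ring
  have h5 : h ≤ h ^ β := by
    simpa using Real.rpow_le_rpow_of_exponent_ge hh (by linarith) hβ1.le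
  have h6 : B * k ≤ B * (3 / 2 * h) := mul_le_mul_of_nonneg_left hk2 hB0
  have h7 : B * h ≤ B * h ^ β := mul_le_mul_of_nonneg_left h5 hB0
  linarith

/-! ### Hölder continuity -/

theorem theorem4p2 (N : ℕ) (q p δ η_minus η_plus M : ℝ)
    (hq : 1 < q) (hpq : 1 / p + 1 / q = 1) (hδ : 1 ≤ δ)
    (hη_minus : 0 ≤ η_minus) (hη_plus : 0 ≤ η_plus) (hM : 0 ≤ M) :
    ∃ θ : ℝ, p < θ ∧ ∀ ρ : ℝ, 0 < ρ → ∃ C : ℝ, 0 ≤ C ∧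
      ∀ O : Set (EuclideanSpace ℝ (Fin N) × ℝ), IsOpen O →
      ∀ H : EuclideanSpace ℝ (Fin N) → ℝ → EuclideanSpace ℝ (Fin N) → ℝ,
        ContinuousOn
          (fun w : (EuclideanSpace ℝ (Fin N) × ℝ) × EuclideanSpace ℝ (Fin N) =>
            H w.1.1 w.1.2 w.2) (O ×ˢ Set.univ) →
        (∀ (x : EuclideanSpace ℝ (Fin N)) (t : ℝ) (z : EuclideanSpace ℝ (Fin N)), (x, t) ∈ O →
          1 / δ * ‖z‖ ^ q - η_minus ≤ H x t z ∧ H x t z ≤ δ * ‖z‖ ^ q + η_plus) →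
      ∀ u : EuclideanSpace ℝ (Fin N) × ℝ → ℝ,
        IsViscositySolution O H u → (∀ z ∈ O, |u z| ≤ M) →
        ∀ (x y : EuclideanSpace ℝ (Fin N)) (t s : ℝ),
          (x, t) ∈ interiorRegion O ρ → (y, s) ∈ interiorRegion O ρ →
          |u (x, t) - u (y, s)| ≤
            C * (‖x - y‖ ^ ((θ - p) / (θ - 1)) + |t - s| ^ ((θ - p) / θ)) := by
  have hpq' : p.HolderConjugate q := by
    refine (Real.holderConjugate_iff.2 ⟨hq, ?_⟩).symm
    rw [← hpq, one_div, one_div, add_comm]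
  have hp := hpq'.lt
  have hp0 := hpq'.pos
  obtain ⟨β, hβ0, hβ1, hβ⟩ := exists_one_sided_modulus N hpq' (by linarith : 0 < δ) hη_minus
    hη_plus hM
  have hβ1' : 0 < 1 - β := by linarith
  have hpβ : 0 < p - 1 + β := by linarith
  -- this `θ` makes the time exponent `(θ - p) / θ` equal to `β`
  refine ⟨p / (1 - β), ?_, fun ρ hρ => ?_⟩
  · rw [lt_div_iff₀ hβ1']; nlinarith
  have e1 : (p / (1 - β) - p) / (p / (1 - β)) = β := by field_simp; ring
  have e2 : (p / (1 - β) - p) / (p / (1 - β) - 1) = p / (p - 1 + β) * β := by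
    have h1 : p / (1 - β) - 1 = (p - 1 + β) / (1 - β) := by field_simp; ring
    have h2 : p / (1 - β) - p = p * β / (1 - β) := by field_simp; ring
    rw [h1, h2]; field_simp
  rw [e1, e2]
  obtain ⟨h₁, C, hh₁, hC, hmod⟩ := hβ ρ hρ
  set C' : ℝ := C + 2 * M / h₁ ^ β with hC'
  have hC'0 : 0 ≤ C' := by positivity
  refine ⟨2 * C', by positivity, fun O _ H _ hH u hu huM x y t s hx hy => ?_⟩
  set d := ‖x - y‖ ^ (p / (p - 1 + β)) with hd
  have hd0 : 0 ≤ d := by positivity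
  -- the smallest scale allowed by the one-sided modulus, up to a constant
  set h := 2 * |t - s| + d with hh
  have habs : 0 ≤ |t - s| := abs_nonneg _
  have hh0 : 0 ≤ h := by positivity
  have hfinal : |u (x, t) - u (y, s)| ≤ C' * h ^ β := by
    rcases hh0.eq_or_lt with h0 | h0
    · have h1 : |t - s| = 0 := by linarith
      have h2 : d = 0 := by linarith
      have h3 : x = y := by
        rw [hd, Real.rpow_eq_zero (norm_nonneg _) (by positivity)] at h2
        exact sub_eq_zero.1 (norm_eq_zero.1 h2)
      have h4 : t = s := sub_eq_zero.1 (abs_eq_zero.1 h1)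
      rw [h3, h4, sub_self, abs_zero]
      positivity
    rcases le_or_gt h h₁ with hle | hgt
    · have hdist : ‖x - y‖ ^ p ≤ h ^ (p - 1 + β) := by
        have h1 : ‖x - y‖ ^ p = d ^ (p - 1 + β) := by
          rw [hd, ← Real.rpow_mul (norm_nonneg _), div_mul_cancel₀ _ hpβ.ne']
        rw [h1]
        exact Real.rpow_le_rpow hd0 (by linarith) hpβ.le
      have h1 := hmod O H hH u hu huM x y t s h hx h0 hle (by linarith) hdist
      have h2 := hmod O H hH u hu huM y x s t h hy h0 hle (by rw [abs_sub_comm]; linarith)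
        (by rwa [norm_sub_rev])
      have h3 : C * h ^ β ≤ C' * h ^ β := by
        have : 0 ≤ 2 * M / h₁ ^ β := by positivity
        gcongr
        linarith
      exact abs_le.2 ⟨by linarith, by linarith⟩
    · have h1 := abs_le.1 (huM _ hx.1)
      have h2 := abs_le.1 (huM _ hy.1)
      have h3 : 2 * M ≤ 2 * M / h₁ ^ β * h ^ β := by
        calc 2 * M = 2 * M / h₁ ^ β * h₁ ^ β := by
              rw [div_mul_cancel₀]
              positivity
          _ ≤ _ := by gcongr
      have h4 : 0 ≤ C * h ^ β := by positivity
      have h5 : C' * h ^ β = C * h ^ β + 2 * M / h₁ ^ β * h ^ β := by rw [hC']; ring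
      exact abs_le.2 ⟨by linarith [h1.1, h2.2], by linarith [h1.2, h2.1]⟩
  have hsplit : h ^ β ≤ 2 * (‖x - y‖ ^ (p / (p - 1 + β) * β) + |t - s| ^ β) := by
    have h1 : h ^ β ≤ (2 * |t - s|) ^ β + d ^ β :=
      Real.rpow_add_le_add_rpow (by positivity) hd0 hβ0.le hβ1.le
    have h2 : (2 * |t - s|) ^ β = 2 ^ β * |t - s| ^ β := Real.mul_rpow (by norm_num) habs
    have h3 : (2 : ℝ) ^ β ≤ 2 := by
      simpa using Real.rpow_le_rpow_of_exponent_le (show (1 : ℝ) ≤ 2 by norm_num) hβ1.le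
    have h4 : d ^ β = ‖x - y‖ ^ (p / (p - 1 + β) * β) := by
      rw [hd, ← Real.rpow_mul (norm_nonneg _)]
    have h5 : 0 ≤ |t - s| ^ β := by positivity
    have h6 : 0 ≤ ‖x - y‖ ^ (p / (p - 1 + β) * β) := by positivity
    rw [h2, h4] at h1
    nlinarith
  calc _ ≤ _ := hfinal
    _ ≤ C' * (2 * (‖x - y‖ ^ (p / (p - 1 + β) * β) + |t - s| ^ β)) := by gcongr
    _ = _ := by ring
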